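/- Let $m,n,d$ be integers with $m,n\ge 2$ and $d>2$ even, and suppose that $(m,d)\neq(2,4)$ or $(n,d)\neq(2,4)$. For $X\in\mathbb{R}^{m\times n}$ let $p(X)\in\mathbb{R}^N$, $N=\sum_{s=0}^{\min\{m,n\}}\binom{m}{s}\binom{n}{s}$, be the vector of all minors of $X$ (the minor of order $0$ being $1$). A function $f:\mathbb{R}^{m\times n}\to\mathbb{R}$ is called polyconvex if $f=g\circ p$ for some convex $g:\mathbb{R}^N\to\mathbb{R}\cup\{+\infty\}$. A polynomial $f$ on $\mathbb{R}^{m\times n}$ is called SOS polyconvex if there is a polynomial map $q:\mathbb{R}^{m\times n}\to\mathbb{R}^N$ such that $f(X)-f(Y)-\langle q(Y),p(X)-p(Y)\rangle$ is a sum of squares of polynomials in the entries of $X$ and $Y$. A polynomial $g$ on $\mathbb{R}^k$ is called SOS convex if $\langle y,\nabla^2 g(x)y\rangle$ is a sum of squares of polynomials in $(x,y)\in\mathbb{R}^k\times\mathbb{R}^k$. Then there exists a polyconvex polynomial $f:\mathbb{R}^{m\times n}\to\mathbb{R}$ of degree $d$ that is not SOS polyconvex. Moreover, $f$ can be taken as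 follows: if $(m,d)\neq(2,4)$, then $f(X)=\hat f(X_{11},\dots,X_{m1})$ for some convex polynomial $\hat f$ on $\mathbb{R}^m$ of degree $d$ that is not SOS convex; if $(m,d)=(2,4)$, then $f(X)=\hat f(X_{11},\dots,X_{1n})$ for some convex polynomial $\hat f$ on $\mathbb{R}^n$ of degree $d$ that is not SOS convex. -/

import Mathlib

namespace PolyconvexSOS

/-- Index set of the minors of an `m × n` matrix: a set of rows and a set of columns with the same
number `s` of elements, `0 ≤ s ≤ min m n` (the minor of order `0` is the constant `1`). Its
cardinality is `N = ∑ s, (m.choose s) * (n.choose s)`. -/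
abbrev MinorIndex (m n : ℕ) : Type :=
  {K : Finset (Fin m) × Finset (Fin n) // K.1.card = K.2.card}

/-- The map `p` sending a matrix to the collection of its minors. The entries may lie in any
commutative ring, so that it applies both to real matrices and to matrices of polynomials. -/
def minors {R : Type*} [CommRing R] {m n : ℕ} (X : Matrix (Fin m) (Fin n) R)
    (K : MinorIndex m n) : R :=
  (X.submatrix (K.1.1.orderEmbOfFin rfl) (K.1.2.orderEmbOfFin K.2.symm)).det

/-- The value at the real matrix `X` of a polynomial in the entries of an `m × n` matrix. -/
noncomputable def evalMatrix {m n : ℕ} (f : MvPolynomial (Fin m × Fin n) ℝ)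
    (X : Matrix (Fin m) (Fin n) ℝ) : ℝ :=
  MvPolynomial.eval (fun ij => X ij.1 ij.2) f

/-- Convexity of a function with values in `ℝ ∪ {+∞}`. -/
def IsExtendedConvex {E : Type*} [AddCommGroup E] [Module ℝ E] (g : E → EReal) : Prop :=
  (∀ x, g x ≠ ⊥) ∧
    ∀ x y : E, ∀ a b : ℝ, 0 < a → 0 < b → a + b = 1 →
      g (a • x + b • y) ≤ (a : EReal) * g x + (b : EReal) * g y

/-- A function on matrices is polyconvex if it is a convex function, with values in `ℝ ∪ {+∞}`,
of the minors. -/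
def IsPolyconvex {m n : ℕ} (f : Matrix (Fin m) (Fin n) ℝ → EReal) : Prop :=
  ∃ g : (MinorIndex m n → ℝ) → EReal, IsExtendedConvex g ∧ ∀ X, f X = g (minors X)

/-- The minors as polynomials in the entries of the matrix. -/
noncomputable def minorPoly {m n : ℕ} (K : MinorIndex m n) : MvPolynomial (Fin m × Fin n) ℝ :=
  minors (Matrix.mvPolynomialX (Fin m) (Fin n) ℝ) K

/-- A polynomial `f` is SOS polyconvex if, for some polynomial map `q` into the space of minors,
`f(X) - f(Y) - ⟨q(Y), p(X) - p(Y)⟩` is a sum of squares of polynomials in the entries of `X` and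
`Y` (the variables `Sum.inl` are the entries of `X`, the variables `Sum.inr` those of `Y`). -/
def IsSOSPolyconvex {m n : ℕ} (f : MvPolynomial (Fin m × Fin n) ℝ) : Prop :=
  ∃ q : MinorIndex m n → MvPolynomial (Fin m × Fin n) ℝ,
    IsSumSq (MvPolynomial.rename Sum.inl f - MvPolynomial.rename Sum.inr f
      - ∑ K : MinorIndex m n, MvPolynomial.rename Sum.inr (q K) *
          (MvPolynomial.rename Sum.inl (minorPoly K) - MvPolynomial.rename Sum.inr (minorPoly K)) :
      MvPolynomial ((Fin m × Fin n) ⊕ (Fin m × Fin n)) ℝ)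

/-- A `k`-variate polynomial is convex if it is so as a function on `ℝ^k`. -/
def IsConvexPoly {k : ℕ} (f : MvPolynomial (Fin k) ℝ) : Prop :=
  ConvexOn ℝ Set.univ (fun x : Fin k → ℝ => MvPolynomial.eval x f)

/-- A `k`-variate polynomial `f` is SOS convex if `⟨y, ∇²f(x) y⟩` is a sum of squares of polynomials
in `(x, y)` (the variables `Sum.inl` are those of `x`, the variables `Sum.inr` those of `y`). -/
def IsSOSConvex {k : ℕ} (f : MvPolynomial (Fin k) ℝ) : Prop :=
  IsSumSq (∑ i : Fin k, ∑ j : Fin k,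
    MvPolynomial.X (Sum.inr i) *
      MvPolynomial.rename Sum.inl (MvPolynomial.pderiv i (MvPolynomial.pderiv j f)) *
      MvPolynomial.X (Sum.inr j) : MvPolynomial (Fin k ⊕ Fin k) ℝ)

end PolyconvexSOS

/-! A matrix supported in a single row or column has no nonzero minor of order at least 2. On such
matrices the minors are therefore affine functions of the entries, and SOS polyconvexity collapses
to SOS convexity.

Precisely, let `g` be a polynomial in the entries of one row or column, and put `X = a + t v`, `Y =
a` in an SOS polyconvexity certificate. The term with `q` becomes `t` times a polynomial in `(a,
v)`, so `g(a + t v) - g(a) - t c(a, v)` is a sum of squares in `ℝ[a, v][t]`. Its coefficient at `t ^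
0` is zero, so every square is divisible by `t ^ 2`. The coefficient at `t ^ 2`, which is half the
Hessian form of `g`, is then a sum of squares: this is `isSOSConvex_of_isSOSPolyconvex_rename`.
Conversely, a convex `g` is a convex function of the minors of order 1, hence polyconvex
(`isPolyconvex_rename`).

It remains to find convex polynomials that are not SOS convex. `bivariateExample` serves for even `d
≥ 6` and `trivariateExample` for `d = 4`; dummy variables give the larger dimensions. Convexity
follows from determinants of Hessians. A sum of squares form of the Hessian is refuted by peeling
off one variable at a time (`exists_affine_of_sum_mul_self_eq`) until real vectors remain that
violate Cauchy–Schwarz. -/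

namespace PolyconvexSOS

open Polynomial

/-! ### Sums of squares in formally real rings and their polynomial rings. -/

section SumsOfSquares

theorem exists_sum_mul_self_of_isSumSq {R : Type*} [CommRing R] {a : R} (h : IsSumSq a) :
    ∃ (n : ℕ) (s : Fin n → R), a = ∑ i, s i * s i := by
  induction h with
  | zero => exact ⟨0, Fin.elim0, by simp⟩
  | sq_add a _ ih =>
    obtain ⟨n, s, rfl⟩ := ih
    exact ⟨n + 1, Fin.cons a s, by simp [Fin.sum_univ_succ]⟩

theorem isFormallyReal_of_sum {R : Type*} [CommRing R]
    (h : ∀ (n : ℕ) (s : Fin n → R), ∑ i, s i * s i = 0 → ∀ i, s i = 0) : IsFormallyReal R := by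
  refine IsFormallyReal.of_eq_zero_of_eq_zero_of_mul_self_add fun {t a} ht hat => ?_
  obtain ⟨n, s, rfl⟩ := exists_sum_mul_self_of_isSumSq ht
  have := h (n + 1) (Fin.cons a s) (by simpa [Fin.sum_univ_succ] using hat) 0
  simpa using this

variable {R : Type*} [CommRing R] [IsFormallyReal R] {ι : Type*} [Fintype ι]

theorem eq_zero_of_sum_mul_self_eq_zero {s : ι → R} (h : ∑ i, s i * s i = 0) (i : ι) :
    s i = 0 := by
  classical
  rw [← Finset.add_sum_erase _ _ (Finset.mem_univ i)] at h
  have h1 := IsFormallyReal.eq_zero_of_add_right (IsSumSq.mul_self (s i))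
    (IsSumSq.sum_mul_self _ s) h
  rwa [← pow_two, pow_eq_zero_iff two_ne_zero] at h1

/-- Leading coefficients of squares cannot cancel in a formally real ring. -/
theorem natDegree_le_of_natDegree_sum_mul_self_le {s : ι → R[X]} {k : ℕ}
    (h : (∑ i, s i * s i).natDegree ≤ 2 * k) (i : ι) : (s i).natDegree ≤ k := by
  -- Here `j` is the excess of an a priori degree bound; it is lowered by one at a time, starting
  -- from the sum of all degrees.
  have key : ∀ j, (∀ i, (s i).natDegree ≤ k + j) → ∀ i, (s i).natDegree ≤ k := by
    intro j
    induction j with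
    | zero => exact fun h => h
    | succ j ih =>
      intro hj
      refine ih fun i => ?_
      have h0 : ∑ i, (s i).coeff (k + (j + 1)) * (s i).coeff (k + (j + 1)) = 0 := by
        have : (∑ i, s i * s i).coeff (k + (j + 1) + (k + (j + 1))) = 0 :=
          coeff_eq_zero_of_natDegree_lt (by omega)
        rw [finsetSum_coeff] at this
        rw [← this]
        exact Finset.sum_congr rfl fun i _ =>
          (coeff_mul_add_eq_of_natDegree_le (hj i) (hj i)).symm
      have h1 := eq_zero_of_sum_mul_self_eq_zero h0 i
      by_contra hlt
      have h2 : (s i).natDegree = k + (j + 1) := le_antisymm (hj i) (by omega)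
      rw [← h2, coeff_natDegree, leadingCoeff_eq_zero] at h1
      rw [h1] at h2
      simp at h2
  refine key (∑ i, (s i).natDegree) (fun i => ?_) i
  have := Finset.single_le_sum (f := fun i => (s i).natDegree) (fun _ _ => Nat.zero_le _)
    (Finset.mem_univ i)
  exact this.trans (Nat.le_add_left _ _)

instance isFormallyReal_polynomial : IsFormallyReal R[X] := by
  refine isFormallyReal_of_sum fun n s hs i => ?_
  have h0 := natDegree_le_of_natDegree_sum_mul_self_le (s := s) (k := 0) (by simp [hs])
  have h1 : ∑ i, (s i).coeff 0 * (s i).coeff 0 = 0 := by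
    have := congrArg (fun p => p.coeff 0) hs
    simpa [mul_coeff_zero] using this
  rw [eq_C_of_natDegree_le_zero (h0 i), eq_zero_of_sum_mul_self_eq_zero h1 i, C_0]

/-- Evaluation at real points reduces this to `ℝ`. -/
instance isFormallyReal_mvPolynomial (σ : Type*) : IsFormallyReal (MvPolynomial σ ℝ) := by
  refine isFormallyReal_of_sum fun n s hs i => MvPolynomial.funext fun x => ?_
  have h := congrArg (MvPolynomial.eval x) hs
  simp only [map_sum, map_mul, map_zero] at h
  simpa using eq_zero_of_sum_mul_self_eq_zero h i

/-- Peels off one variable: a sum of squares quadratic in `X` yields a Gram-type factorization of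
its coefficients over `R`. In `ℝ[X][X][X]` it can be applied again to the sums obtained. -/
theorem exists_affine_of_sum_mul_self_eq {s : ι → R[X]} {p q r : R}
    (h : ∑ i, s i * s i = C p + C q * X + C r * X ^ 2) :
    ∃ a b : ι → R, (∀ i, s i = C (a i) + C (b i) * X) ∧
      ∑ i, a i * a i = p ∧ 2 * ∑ i, a i * b i = q ∧ ∑ i, b i * b i = r := by
  have hd := natDegree_le_of_natDegree_sum_mul_self_le (s := s) (k := 1) (by
    rw [h]; compute_degree)
  have hs : ∀ i, s i = C ((s i).coeff 0) + C ((s i).coeff 1) * X := fun i => by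
    rw [add_comm]; exact eq_X_add_C_of_natDegree_le_one (hd i)
  refine ⟨fun i => (s i).coeff 0, fun i => (s i).coeff 1, hs, ?_⟩
  have hsq : ∑ i, s i * s i = C (∑ i, (s i).coeff 0 * (s i).coeff 0)
      + C (2 * ∑ i, (s i).coeff 0 * (s i).coeff 1) * X
      + C (∑ i, (s i).coeff 1 * (s i).coeff 1) * X ^ 2 := by
    simp only [Finset.mul_sum, map_sum, Finset.sum_mul, ← Finset.sum_add_distrib]
    refine Finset.sum_congr rfl fun i _ => ?_
    conv_lhs => rw [hs i]
    simp only [map_mul, map_ofNat]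
    ring
  rw [hsq] at h
  have hc : ∀ (a b c : R) (k : ℕ), (C a + C b * X + C c * X ^ 2).coeff k
      = (if k = 0 then a else 0) + b * (if 1 = k then 1 else 0) + c * (if k = 2 then 1 else 0) := by
    intro a b c k
    simp only [coeff_add, coeff_C_mul, coeff_C, coeff_X, coeff_X_pow]
  have h' := fun k => congrArg (fun t => t.coeff k) h
  simp only [hc] at h'
  exact ⟨by simpa using h' 0, by simpa using h' 1, by simpa using h' 2⟩

end SumsOfSquares

/-! ### Taylor coefficients along a line, over an arbitrary coefficient ring. -/

section Directional

variable {k : ℕ} {R : Type*} [CommRing R] [Algebra ℝ R]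

/-- The polynomial `g` along the line `t ↦ a + t v`. -/
noncomputable def alongLine (a v : Fin k → R) : MvPolynomial (Fin k) ℝ →ₐ[ℝ] R[X] :=
  MvPolynomial.aeval fun i => C (a i) + X * C (v i)

theorem derivative_alongLine (a v : Fin k → R) (g : MvPolynomial (Fin k) ℝ) :
    derivative (alongLine a v g) = ∑ i, C (v i) * alongLine a v (MvPolynomial.pderiv i g) := by
  classical
  induction g using MvPolynomial.induction_on with
  | C r => simp [alongLine, IsScalarTower.algebraMap_apply ℝ R R[X]]
  | add p q hp hq => simp [hp, hq, mul_add, Finset.sum_add_distrib]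
  | mul_X p j hp =>
    simp only [map_mul, derivative_mul, hp, Derivation.leibniz, smul_eq_mul, map_add,
      MvPolynomial.pderiv_X]
    simp only [mul_add, Finset.sum_add_distrib]
    rw [add_comm]
    congr 1
    · rw [Finset.sum_eq_single j]
      · simp [alongLine]; ring
      · intro b _ hb
        simp [Pi.single_eq_of_ne hb.symm]
      · simp
    · rw [Finset.sum_mul]
      refine Finset.sum_congr rfl fun i _ => ?_
      ring

theorem derivative_derivative_alongLine (a v : Fin k → R) (g : MvPolynomial (Fin k) ℝ) :
    derivative (derivative (alongLine a v g)) = ∑ i, ∑ j,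
      C (v i) * alongLine a v (MvPolynomial.pderiv i (MvPolynomial.pderiv j g)) * C (v j) := by
  rw [derivative_alongLine, derivative_sum, Finset.sum_comm]
  refine Finset.sum_congr rfl fun i _ => ?_
  simp only [derivative_mul, derivative_C, zero_mul, zero_add, derivative_alongLine,
    Finset.mul_sum]
  exact Finset.sum_congr rfl fun j _ => by ring

theorem coeff_zero_alongLine (a v : Fin k → R) (g : MvPolynomial (Fin k) ℝ) :
    (alongLine a v g).coeff 0 = MvPolynomial.aeval a g := by
  have h : ((aeval (0 : R)).restrictScalars ℝ).comp (alongLine a v) = MvPolynomial.aeval a := by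
    ext i
    simp [alongLine]
  rw [← h, coeff_zero_eq_aeval_zero]
  rfl

theorem two_mul_coeff_two_alongLine (a v : Fin k → R) (g : MvPolynomial (Fin k) ℝ) :
    2 * (alongLine a v g).coeff 2 = ∑ i, ∑ j,
      v i * MvPolynomial.aeval a (MvPolynomial.pderiv i (MvPolynomial.pderiv j g)) * v j := by
  have h := congrArg (fun p => p.coeff 0) (derivative_derivative_alongLine a v g)
  simp only [finsetSum_coeff, coeff_mul_C, coeff_C_mul, coeff_zero_alongLine,
    coeff_derivative] at h
  rw [← h]
  norm_num
  ring

end Directional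

/-! ### Convexity from a nonnegative Hessian form. -/

section Convexity

variable {k : ℕ}

theorem eval_alongLine (a v : Fin k → ℝ) (g : MvPolynomial (Fin k) ℝ) (t : ℝ) :
    (alongLine a v g).eval t = MvPolynomial.eval (fun i => a i + t * v i) g := by
  have h : (aeval t).comp (alongLine a v) = MvPolynomial.aeval fun i => a i + t * v i := by
    ext i
    simp [alongLine]
    ring
  exact congrArg (fun φ => φ g) h

theorem isConvexPoly_of_hessian_nonneg {g : MvPolynomial (Fin k) ℝ}
    (h : ∀ x v : Fin k → ℝ, 0 ≤ ∑ i, ∑ j,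
      v i * MvPolynomial.eval x (MvPolynomial.pderiv i (MvPolynomial.pderiv j g)) * v j) :
    IsConvexPoly g := by
  refine ⟨convex_univ, fun x _ y _ a b ha hb hab => ?_⟩
  have hderiv (p : ℝ[X]) : deriv (fun t => p.eval t) = fun t => p.derivative.eval t := by
    ext t; simp
  have hconv : ConvexOn ℝ Set.univ fun t => (alongLine x (y - x) g).eval t := by
    refine convexOn_univ_of_deriv2_nonneg (Polynomial.differentiable _) ?_ fun t => ?_
    · rw [hderiv]; exact Polynomial.differentiable _
    · rw [Function.iterate_succ, Function.iterate_one, Function.comp_apply, hderiv, hderiv]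
      simp only [derivative_derivative_alongLine, eval_finsetSum, eval_mul, eval_C,
        eval_alongLine]
      exact h _ _
  have key := hconv.2 (Set.mem_univ 0) (Set.mem_univ 1) ha hb hab
  simp only [eval_alongLine] at key
  have h0 : (fun i => x i + (a • (0 : ℝ) + b • 1) * (y - x) i) = a • x + b • y := by
    ext i
    simp only [Pi.add_apply, Pi.smul_apply, smul_eq_mul, Pi.sub_apply]
    linear_combination (-x i) * hab
  rw [h0] at key
  simpa using key

end Convexity

theorem isSumSq_map {R S F : Type*} [Semiring R] [Semiring S] [FunLike F R S] [RingHomClass F R S]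
    (φ : F) {a : R} (h : IsSumSq a) : IsSumSq (φ a) := by
  induction h with
  | zero => simp
  | sq_add a _ ih =>
    rw [map_add, map_mul]
    exact .sq_add _ ih

theorem aeval_X_comp {σ τ : Type*} (f : σ → τ) (p : MvPolynomial σ ℝ) :
    MvPolynomial.aeval (fun i => (MvPolynomial.X (f i) : MvPolynomial τ ℝ)) p
      = MvPolynomial.rename f p :=
  DFunLike.congr_fun (by ext; simp :
    MvPolynomial.aeval (fun i => (MvPolynomial.X (f i) : MvPolynomial τ ℝ))
      = MvPolynomial.rename f) p

/-! ### Minors of matrices supported in one row or column. -/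

section Minors

variable {m n : ℕ}

theorem map_minors {R S : Type*} [CommRing R] [CommRing S] (φ : R →+* S)
    (X : Matrix (Fin m) (Fin n) R) (K : MinorIndex m n) :
    φ (minors X K) = minors (X.map φ) K := by
  simp only [minors, RingHom.map_det, RingHom.mapMatrix_apply]
  rfl

theorem minors_eq_one {R : Type*} [CommRing R] (X : Matrix (Fin m) (Fin n) R)
    {K : MinorIndex m n} (hK : K.1.1.card = 0) : minors X K = 1 := by
  have : IsEmpty (Fin K.1.1.card) := by rw [hK]; infer_instance
  exact Matrix.det_isEmpty

theorem exists_forall_minors_eq_entry (K : MinorIndex m n) (hK : K.1.1.card = 1) :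
    ∃ i j, K.1.1 = {i} ∧ K.1.2 = {j} ∧
      ∀ {R : Type} [CommRing R] (X : Matrix (Fin m) (Fin n) R), minors X K = X i j := by
  obtain ⟨i, hi⟩ := Finset.card_eq_one.mp hK
  obtain ⟨j, hj⟩ := Finset.card_eq_one.mp (K.2.symm.trans hK)
  refine ⟨i, j, hi, hj, fun {R} _ X => ?_⟩
  have k : Fin K.1.1.card := ⟨0, by omega⟩
  have h1 : K.1.1.orderEmbOfFin rfl k = i := by
    have := K.1.1.orderEmbOfFin_mem rfl k
    exact Finset.mem_singleton.mp (hi.subset this)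
  have h2 : K.1.2.orderEmbOfFin K.2.symm k = j := by
    have := K.1.2.orderEmbOfFin_mem K.2.symm k
    exact Finset.mem_singleton.mp (hj.subset this)
  rw [minors, Matrix.det_eq_elem_of_card_eq_one (by simpa using hK) k, Matrix.submatrix_apply,
    h1, h2]

theorem minors_eq_zero_of_col {R : Type*} [CommRing R] {X : Matrix (Fin m) (Fin n) R}
    {K : MinorIndex m n} (hK : 2 ≤ K.1.1.card) (j₀ : Fin n) (hX : ∀ i j, j ≠ j₀ → X i j = 0) :
    minors X K = 0 := by
  obtain ⟨c, hc⟩ : ∃ c, K.1.2.orderEmbOfFin K.2.symm c ≠ j₀ := by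
    by_contra! h
    have := (K.1.2.orderEmbOfFin K.2.symm).injective
      ((h ⟨0, by omega⟩).trans (h ⟨1, by omega⟩).symm)
    simp at this
  exact Matrix.det_eq_zero_of_column_eq_zero c fun i => hX _ _ hc

theorem minors_eq_zero_of_row {R : Type*} [CommRing R] {X : Matrix (Fin m) (Fin n) R}
    {K : MinorIndex m n} (hK : 2 ≤ K.1.1.card) (i₀ : Fin m) (hX : ∀ i j, i ≠ i₀ → X i j = 0) :
    minors X K = 0 := by
  obtain ⟨c, hc⟩ : ∃ c, K.1.1.orderEmbOfFin rfl c ≠ i₀ := by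
    by_contra! h
    have := (K.1.1.orderEmbOfFin rfl).injective
      ((h ⟨0, by omega⟩).trans (h ⟨1, by omega⟩).symm)
    simp at this
  exact Matrix.det_eq_zero_of_row_eq_zero c fun j => hX _ _ hc

/-- An injective placement of `k` variables among the entries of an `m × n` matrix such that the
minors of order at least `2` of a matrix vanish when it is zero outside of these entries. -/
structure IsRankOnePlacement {k : ℕ} (e : Fin k → Fin m × Fin n) : Prop where
  injective : Function.Injective e
  minors_eq_zero : ∀ {R : Type} [CommRing R] (X : Matrix (Fin m) (Fin n) R) (K : MinorIndex m n),
    2 ≤ K.1.1.card → (∀ i j, (i, j) ∉ Set.range e → X i j = 0) → minors X K = 0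

theorem isRankOnePlacement_col (j₀ : Fin n) :
    IsRankOnePlacement (fun i : Fin m => (i, j₀)) where
  injective _ _ h := congrArg Prod.fst h
  minors_eq_zero _ _ hK hX := minors_eq_zero_of_col hK j₀ fun i j hj =>
    hX i j fun ⟨_, ha⟩ => hj (congrArg Prod.snd ha).symm

theorem isRankOnePlacement_row (i₀ : Fin m) :
    IsRankOnePlacement (fun j : Fin n => (i₀, j)) where
  injective _ _ h := congrArg Prod.snd h
  minors_eq_zero _ _ hK hX := minors_eq_zero_of_row hK i₀ fun i j hi =>
    hX i j fun ⟨_, ha⟩ => hi (congrArg Prod.fst ha).symm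

end Minors

/-! ### Convex polynomials of some entries are polyconvex. -/

section Polyconvexity

variable {m n k : ℕ}

theorem isPolyconvex_rename {g : MvPolynomial (Fin k) ℝ} (hg : IsConvexPoly g)
    (e : Fin k → Fin m × Fin n) :
    IsPolyconvex fun X => (evalMatrix (MvPolynomial.rename e g) X : EReal) := by
  -- The minors of order 1 recover the entries, so the convex function may ignore all other minors.
  let K : Fin k → MinorIndex m n := fun a => ⟨({(e a).1}, {(e a).2}), by simp⟩
  have hK : ∀ (a : Fin k) (X : Matrix (Fin m) (Fin n) ℝ), minors X (K a) = X (e a).1 (e a).2 := by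
    intro a X
    obtain ⟨i, j, hi, hj, h⟩ := exists_forall_minors_eq_entry (K a) (by simp [K])
    rw [h, ← Finset.singleton_inj.mp hi, ← Finset.singleton_inj.mp hj]
  refine ⟨fun P => ((MvPolynomial.eval (fun a => P (K a)) g : ℝ) : EReal),
    ⟨fun _ => EReal.coe_ne_bot _, fun P Q a b ha hb hab => ?_⟩, fun X => ?_⟩
  · have := hg.2 (Set.mem_univ fun i => P (K i)) (Set.mem_univ fun i => Q (K i)) ha.le hb.le hab
    simp only [smul_eq_mul] at this
    have h2 := EReal.coe_le_coe_iff.mpr this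
    rwa [EReal.coe_add, EReal.coe_mul, EReal.coe_mul] at h2
  · simp only [evalMatrix, MvPolynomial.eval_rename, hK]
    rfl

end Polyconvexity

/-! ### SOS polyconvexity implies SOS convexity on rank-one placements. -/

section Reduction

variable {m n k : ℕ}

/-- The matrix whose entries at the places `e a` are `w a`, all others being zero. -/
noncomputable def placed {R : Type*} [Zero R] (e : Fin k → Fin m × Fin n) (w : Fin k → R)
    (ij : Fin m × Fin n) : R :=
  Function.extend e w 0 ij

theorem isSOSConvex_of_isSOSPolyconvex_rename {e : Fin k → Fin m × Fin n}
    (he : IsRankOnePlacement e) {g : MvPolynomial (Fin k) ℝ}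
    (h : IsSOSPolyconvex (MvPolynomial.rename e g)) : IsSOSConvex g := by
  obtain ⟨q, hq⟩ := h
  let R := MvPolynomial (Fin k ⊕ Fin k) ℝ
  let a : Fin k → R := fun i => MvPolynomial.X (Sum.inl i)
  let v : Fin k → R := fun i => MvPolynomial.X (Sum.inr i)
  -- The polynomial variable plays the role of `t`: `X` becomes `a + t v` and `Y` becomes `a` at the
  -- places `e`, both zero elsewhere.
  let Xm : Fin m × Fin n → R[X] := placed e fun i => C (a i) + X * C (v i)
  let Ym : Fin m × Fin n → R[X] := placed e fun i => C (a i)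
  let φ : MvPolynomial ((Fin m × Fin n) ⊕ (Fin m × Fin n)) ℝ →ₐ[ℝ] R[X] :=
    MvPolynomial.aeval (Sum.elim Xm Ym)
  have hXe : ∀ i, Xm (e i) = C (a i) + X * C (v i) := fun i => he.injective.extend_apply _ _ i
  have hYe : ∀ i, Ym (e i) = C (a i) := fun i => he.injective.extend_apply _ _ i
  have hX0 : ∀ ij, ij ∉ Set.range e → Xm ij = 0 := fun ij h => Function.extend_apply' _ _ _ h
  have hY0 : ∀ ij, ij ∉ Set.range e → Ym ij = 0 := fun ij h => Function.extend_apply' _ _ _ h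
  have hl : ∀ p, φ (MvPolynomial.rename Sum.inl p) = MvPolynomial.aeval Xm p := fun p => by
    simp [φ, MvPolynomial.aeval_rename, Function.comp_def]
  have hr : ∀ p, φ (MvPolynomial.rename Sum.inr p) = MvPolynomial.aeval Ym p := fun p => by
    simp [φ, MvPolynomial.aeval_rename, Function.comp_def]
  have hminor : ∀ (Z : Fin m × Fin n → R[X]) (K : MinorIndex m n),
      MvPolynomial.aeval Z (minorPoly K) = minors (Matrix.of fun i j => Z (i, j)) K := by
    intro Z K
    have := map_minors (MvPolynomial.aeval Z : _ →ₐ[ℝ] R[X]).toRingHom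
      (Matrix.mvPolynomialX (Fin m) (Fin n) ℝ) K
    refine this.trans (congrArg (fun M => minors M K) ?_)
    ext i j
    simp [Matrix.mvPolynomialX]
  -- Order 0 contributes nothing, order 1 contributes `t v` or nothing, and higher orders vanish.
  have hdiff : ∀ K : MinorIndex m n, ∃ c : R,
      MvPolynomial.aeval Xm (minorPoly K) - MvPolynomial.aeval Ym (minorPoly K) = C c * X := by
    intro K
    rw [hminor, hminor]
    rcases Nat.lt_or_ge K.1.1.card 2 with hlt | hge
    · obtain hK | hK : K.1.1.card = 0 ∨ K.1.1.card = 1 := by omega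
      · exact ⟨0, by simp [minors_eq_one _ hK]⟩
      · obtain ⟨i, j, -, -, hent⟩ := exists_forall_minors_eq_entry K hK
        rw [hent, hent, Matrix.of_apply, Matrix.of_apply]
        by_cases hij : (i, j) ∈ Set.range e
        · obtain ⟨b, hb⟩ := hij
          exact ⟨v b, by rw [← hb, hXe, hYe]; ring⟩
        · exact ⟨0, by simp [hX0 _ hij, hY0 _ hij]⟩
    · exact ⟨0, by
        rw [he.minors_eq_zero (Matrix.of fun i j => Xm (i, j)) K hge fun i j h => hX0 _ h,
          he.minors_eq_zero (Matrix.of fun i j => Ym (i, j)) K hge fun i j h => hY0 _ h]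
        simp⟩
  -- The values `q(Y)` are free of `t`, so the whole `q` term is linear in `t` and affects only the
  -- coefficient of degree 1.
  have hYC : ∀ p : MvPolynomial (Fin m × Fin n) ℝ, ∃ c : R, MvPolynomial.aeval Ym p = C c := by
    intro p
    refine ⟨MvPolynomial.aeval (placed e a) p, ?_⟩
    have : (MvPolynomial.aeval Ym : _ →ₐ[ℝ] R[X])
        = (CAlgHom : R →ₐ[ℝ] R[X]).comp (MvPolynomial.aeval (placed e a)) := by
      ext ij : 1
      by_cases hij : ij ∈ Set.range e
      · obtain ⟨b, rfl⟩ := hij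
        simp [hYe, placed, he.injective.extend_apply]
      · simp [hY0 _ hij, placed, Function.extend_apply' _ _ _ hij]
    rw [this]; rfl
  choose c hc using hdiff
  choose y hy using hYC
  have hsos := isSumSq_map φ hq
  obtain ⟨N, s, hs⟩ := exists_sum_mul_self_of_isSumSq hsos
  have hG : MvPolynomial.aeval Xm (MvPolynomial.rename e g) = alongLine a v g := by
    simp [MvPolynomial.aeval_rename, alongLine, Function.comp_def, hXe]
  have hG0 : MvPolynomial.aeval Ym (MvPolynomial.rename e g) = C (MvPolynomial.aeval a g) := by
    have : (MvPolynomial.aeval fun i => C (a i) : _ →ₐ[ℝ] R[X])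
        = (CAlgHom : R →ₐ[ℝ] R[X]).comp (MvPolynomial.aeval a) := by
      ext i : 1
      simp
    rw [MvPolynomial.aeval_rename, Function.comp_def]
    simp only [hYe]
    rw [this]; rfl
  simp only [map_sub, map_sum, map_mul, hl, hr, hG, hG0, hc] at hs
  simp only [hy, ← mul_assoc, ← map_mul] at hs
  have h0 : ∑ i, (s i).coeff 0 * (s i).coeff 0 = 0 := by
    have := congrArg (fun p => p.coeff 0) hs
    simp only [finsetSum_coeff, mul_coeff_zero, coeff_sub, coeff_C_zero, coeff_zero_alongLine,
      coeff_X_zero, mul_zero, Finset.sum_const_zero, sub_self] at this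
    exact this.symm
  have hs0 := eq_zero_of_sum_mul_self_eq_zero h0
  -- Since the constant terms of the `s i` vanish, only the product of linear coefficients survives
  -- at `t ^ 2`.
  have h2 : (alongLine a v g).coeff 2 = ∑ i, (s i).coeff 1 * (s i).coeff 1 := by
    have := congrArg (fun p => p.coeff 2) hs
    simp only [finsetSum_coeff, coeff_sub, coeff_C_mul, coeff_X] at this
    simp only [coeff_C, mul_zero, Finset.sum_const_zero, sub_zero, OfNat.ofNat_ne_zero, if_false,
      OfNat.one_ne_ofNat] at this
    rw [this]
    refine Finset.sum_congr rfl fun i _ => ?_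
    rw [coeff_mul, Finset.Nat.sum_antidiagonal_eq_sum_range_succ
      (fun a b => (s i).coeff a * (s i).coeff b)]
    simp [Finset.sum_range_succ, hs0]
  have hfin := two_mul_coeff_two_alongLine a v g
  have hren : ∀ p, MvPolynomial.aeval a p = MvPolynomial.rename Sum.inl p := fun p => aeval_X_comp _ p
  simp only [hren] at hfin
  rw [IsSOSConvex, ← hfin, h2, two_mul]
  exact (IsSumSq.sum_mul_self _ _).add (IsSumSq.sum_mul_self _ _)

end Reduction

/-! ### Adding dummy variables. -/

section Rename

variable {k l : ℕ} {e : Fin k → Fin l}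

theorem totalDegree_rename_of_injective {σ τ : Type*} {f : σ → τ} (hf : Function.Injective f)
    (p : MvPolynomial σ ℝ) : (MvPolynomial.rename f p).totalDegree = p.totalDegree := by
  refine le_antisymm (MvPolynomial.totalDegree_rename_le f p) ?_
  classical
  simp only [MvPolynomial.totalDegree, MvPolynomial.support_rename_of_injective hf,
    Finset.sup_image]
  refine Finset.sup_mono_fun fun s _ => ?_
  simp [Finsupp.sum_mapDomain_index_inj hf]

theorem IsConvexPoly.rename {g : MvPolynomial (Fin k) ℝ} (hg : IsConvexPoly g)
    (e : Fin k → Fin l) : IsConvexPoly (MvPolynomial.rename e g) := by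
  refine ⟨convex_univ, fun x _ y _ a b ha hb hab => ?_⟩
  simp only [MvPolynomial.eval_rename]
  exact hg.2 (Set.mem_univ (x ∘ e)) (Set.mem_univ (y ∘ e)) ha hb hab

theorem pderiv_rename_eq_zero {i : Fin l} (hi : i ∉ Set.range e) (g : MvPolynomial (Fin k) ℝ) :
    MvPolynomial.pderiv i (MvPolynomial.rename e g) = 0 := by
  classical
  refine MvPolynomial.pderiv_eq_zero_of_notMem_vars fun hv => hi ?_
  have := MvPolynomial.vars_rename e g hv
  simp only [Finset.mem_image] at this
  obtain ⟨a, -, ha⟩ := this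
  exact ⟨a, ha⟩

/-- Setting the dummy variables to zero, both in the point and in the direction, turns one Hessian
form into the other. -/
theorem isSOSConvex_of_rename (he : Function.Injective e) {g : MvPolynomial (Fin k) ℝ}
    (h : IsSOSConvex (MvPolynomial.rename e g)) : IsSOSConvex g := by
  classical
  let φ : MvPolynomial (Fin l ⊕ Fin l) ℝ →ₐ[ℝ] MvPolynomial (Fin k ⊕ Fin k) ℝ :=
    MvPolynomial.aeval (Sum.elim (Function.extend e (fun i => MvPolynomial.X (Sum.inl i)) 0)
      (Function.extend e (fun i => MvPolynomial.X (Sum.inr i)) 0))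
  have hφ : ∀ p, φ (MvPolynomial.rename Sum.inl (MvPolynomial.rename e p))
      = MvPolynomial.rename Sum.inl p := fun p => by
    simp only [φ, MvPolynomial.rename_rename, MvPolynomial.aeval_rename]
    simp only [Function.comp_def, Sum.elim_inl, he.extend_apply, aeval_X_comp]
  have hv : ∀ i, φ (MvPolynomial.X (Sum.inr (e i))) = MvPolynomial.X (Sum.inr i) := fun i => by
    simp [φ, he.extend_apply]
  have key := isSumSq_map φ h
  have hsub : ∀ F : Fin l → MvPolynomial (Fin k ⊕ Fin k) ℝ,
      (∀ i, i ∉ Set.range e → F i = 0) → ∑ i, F i = ∑ i, F (e i) := fun F hF => by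
    refine (Finset.sum_of_injOn e he.injOn (by simp) (fun i _ hi => hF i ?_) (by simp)).symm
    simpa using hi
  simp only [map_sum, map_mul] at key
  rw [hsub _ fun i hi => Finset.sum_eq_zero fun j _ => ?_] at key
  · simp only [hv] at key
    have hin : ∀ i, ∑ j, MvPolynomial.X (Sum.inr i) * φ (MvPolynomial.rename Sum.inl
        (MvPolynomial.pderiv (e i) (MvPolynomial.pderiv j (MvPolynomial.rename e g))))
          * φ (MvPolynomial.X (Sum.inr j))
        = ∑ j, MvPolynomial.X (Sum.inr i) * MvPolynomial.rename Sum.inl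
          (MvPolynomial.pderiv i (MvPolynomial.pderiv j g)) * MvPolynomial.X (Sum.inr j) := by
      intro i
      rw [hsub _ fun j hj => by simp [pderiv_rename_eq_zero hj]]
      simp only [hv, MvPolynomial.pderiv_rename he, hφ]
    simp only [hin] at key
    exact key
  · by_cases hj : j ∈ Set.range e
    · obtain ⟨b, rfl⟩ := hj
      simp [MvPolynomial.pderiv_rename he, pderiv_rename_eq_zero hi]
    · simp [pderiv_rename_eq_zero hj]

end Rename

theorem aeval_eq_eval {σ : Type*} (x : σ → ℝ) (p : MvPolynomial σ ℝ) :
    MvPolynomial.aeval x p = MvPolynomial.eval x p := by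
  rw [← MvPolynomial.coe_aeval_eq_eval]
  rfl

/-! ### A convex, not SOS convex polynomial in two variables, of even degree at least 6. -/

section Bivariate

/-- The polynomial `x² + x⁴ + x² y² + y⁶ + y^d`. -/
noncomputable def bivariateExample (d : ℕ) : MvPolynomial (Fin 2) ℝ :=
  .X 0 ^ 2 + .X 0 ^ 4 + .X 0 ^ 2 * .X 1 ^ 2 + .X 1 ^ 6 + .X 1 ^ d

theorem hessian_bivariateExample (d : ℕ) {S : Type*} [CommRing S] [Algebra ℝ S] (x v : Fin 2 → S) :
    ∑ i, ∑ j, v i * MvPolynomial.aeval x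
      (MvPolynomial.pderiv i (MvPolynomial.pderiv j (bivariateExample d))) * v j
    = v 0 ^ 2 * (2 + 12 * x 0 ^ 2 + 2 * x 1 ^ 2) + 8 * (v 0 * v 1 * x 0 * x 1)
      + v 1 ^ 2 * (2 * x 0 ^ 2 + 30 * x 1 ^ 4 + (d * (d - 1 : ℕ) : ℕ) * x 1 ^ (d - 2)) := by
  have h01 : (0 : Fin 2) ≠ 1 := by decide
  simp only [Fin.sum_univ_two, bivariateExample, map_add, Derivation.leibniz,
    Derivation.leibniz_pow, MvPolynomial.pderiv_X_self, MvPolynomial.pderiv_X_of_ne h01,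
    MvPolynomial.pderiv_X_of_ne h01.symm, smul_eq_mul, map_mul, map_pow,
    MvPolynomial.aeval_X, map_one, map_zero, Derivation.map_one_eq_zero, nsmul_eq_mul, map_natCast,
    Derivation.map_natCast]
  push_cast
  simp only [Nat.sub_sub]
  ring

/-- The left side is the Hessian form in direction `(1, t)`, with `t` the outermost variable, then
`x`, then `y`. The mixed term `8 x y t` is too large: only the `y` part `γ` of `A0` (with `∑ γ² =
2`) and the constant part `β` of `B1` (with `∑ β² = 2`) can produce it. -/
theorem bivariate_ne_sum_mul_self {d : ℕ} (hd : 6 ≤ d) (c : ℝ) {n : ℕ} (s : Fin n → ℝ[X][X][X]) :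
    (C (C (2 + 2 * X ^ 2) + C 12 * X ^ 2) + C (C (8 * X) * X) * X
      + C (C (30 * X ^ 4 + C c * X ^ (d - 2)) + C 2 * X ^ 2) * X ^ 2 : ℝ[X][X][X])
      ≠ ∑ i, s i * s i := by
  intro hs
  obtain ⟨A, B, -, hA, hAB, hB⟩ := exists_affine_of_sum_mul_self_eq hs.symm
  obtain ⟨A0, A1, hA', hA0, -, -⟩ := exists_affine_of_sum_mul_self_eq (p := 2 + 2 * X ^ 2)
    (q := 0) (r := 12) (by rw [hA]; simp)
  obtain ⟨B0, B1, hB', hB0, -, hB1⟩ := exists_affine_of_sum_mul_self_eq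
    (p := 30 * X ^ 4 + C c * X ^ (d - 2)) (q := 0) (r := 2) (by rw [hB]; simp)
  obtain ⟨α, γ, hA0', -, -, hγ⟩ := exists_affine_of_sum_mul_self_eq (p := 2)
    (q := 0) (r := 2) (hA0.trans (by simp only [map_ofNat, map_zero]; ring))
  obtain ⟨β, β', hB1', hβ, -, hβ'⟩ := exists_affine_of_sum_mul_self_eq (p := 2)
    (q := 0) (r := 0) (hB1.trans (by simp only [map_ofNat, map_zero]; ring))
  replace hβ' := eq_zero_of_sum_mul_self_eq_zero hβ'
  -- As `d - 2 ≥ 4`, the sum of the `B0 i` squared is divisible by `y ^ 4`, so each `B0 i` is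
  -- divisible by `y ^ 2` and `A1 * B0` has no term in `y`.
  have hB00 : ∀ i, (B0 i).coeff 0 = 0 := by
    refine eq_zero_of_sum_mul_self_eq_zero ?_
    have := congrArg (fun p => p.coeff 0) hB0
    simp only [finsetSum_coeff, mul_coeff_zero] at this
    rw [this]
    simp [coeff_X_pow, show (0 : ℕ) ≠ d - 2 by omega]
  have hB01 : ∀ i, (B0 i).coeff 1 = 0 := by
    refine eq_zero_of_sum_mul_self_eq_zero ?_
    have := congrArg (fun p => p.coeff 2) hB0
    simp only [finsetSum_coeff, coeff_mul, Finset.Nat.sum_antidiagonal_eq_sum_range_succ_mk,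
      Finset.sum_range_succ, hB00] at this
    simpa [coeff_X_pow, show (2 : ℕ) ≠ d - 2 by omega] using this
  have key : 2 * ∑ i, γ i * β i = 8 := by
    have := congrArg (fun p => (p.coeff 1).coeff 1) hAB
    simpa [hA', hB', mul_coeff_one, coeff_C, hB00, hB01, hA0', hB1', hβ'] using this
  -- The sum equals `2 - 8 + 2 < 0`.
  have h3 : 0 ≤ ∑ i, (γ i - β i) * (γ i - β i) := Finset.sum_nonneg fun i _ => mul_self_nonneg _
  have h4 : ∑ i, (γ i - β i) * (γ i - β i)
      = ∑ i, γ i * γ i - 2 * ∑ i, γ i * β i + ∑ i, β i * β i := by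
    rw [Finset.mul_sum, ← Finset.sum_sub_distrib, ← Finset.sum_add_distrib]
    exact Finset.sum_congr rfl fun i _ => by ring
  linarith

theorem not_isSOSConvex_bivariateExample {d : ℕ} (hd : 6 ≤ d) :
    ¬ IsSOSConvex (bivariateExample d) := by
  intro h
  let φ : MvPolynomial (Fin 2 ⊕ Fin 2) ℝ →ₐ[ℝ] ℝ[X][X][X] :=
    MvPolynomial.aeval
    (Sum.elim (![C X, C (C X)] : Fin 2 → ℝ[X][X][X]) (![1, X] : Fin 2 → ℝ[X][X][X]))
  have h1 := isSumSq_map φ h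
  simp only [map_sum, map_mul, φ, MvPolynomial.aeval_X, MvPolynomial.aeval_rename,
    Sum.elim_comp_inl, Sum.elim_inr] at h1
  rw [hessian_bivariateExample d (S := ℝ[X][X][X])] at h1
  obtain ⟨n, s, hs⟩ := exists_sum_mul_self_of_isSumSq (R := ℝ[X][X][X]) h1
  refine bivariate_ne_sum_mul_self hd (d * (d - 1 : ℕ) : ℕ) s (Eq.trans ?_ hs)
  simp only [Matrix.cons_val_zero, Matrix.cons_val_one, map_add, map_mul, map_pow, map_ofNat,
    map_natCast]
  ring

theorem isConvexPoly_bivariateExample {d : ℕ} (hd : Even d) :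
    IsConvexPoly (bivariateExample d) := by
  refine isConvexPoly_of_hessian_nonneg fun x v => ?_
  have h := hessian_bivariateExample d x v
  simp only [aeval_eq_eval] at h
  rw [h]
  -- For even `d` the contribution of `y ^ d` is nonnegative, so positivity of the determinant is
  -- needed only without it.
  have hK : 0 ≤ ((d * (d - 1 : ℕ) : ℕ) : ℝ) * x 1 ^ (d - 2) :=
    mul_nonneg (Nat.cast_nonneg _) ((hd.tsub even_two).pow_nonneg _)
  set K := ((d * (d - 1 : ℕ) : ℕ) : ℝ) * x 1 ^ (d - 2)
  generalize x 0 = a at *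
  generalize x 1 = b at *
  generalize v 0 = p at *
  generalize v 1 = q at *
  have hA : 0 < 2 + 12 * a ^ 2 + 2 * b ^ 2 := by positivity
  have hdet : 0 ≤ (2 + 12 * a ^ 2 + 2 * b ^ 2) * (2 * a ^ 2 + 30 * b ^ 4) - (4 * a * b) ^ 2 := by
    have : (2 + 12 * a ^ 2 + 2 * b ^ 2) * (2 * a ^ 2 + 30 * b ^ 4) - (4 * a * b) ^ 2
        = a ^ 2 * (3 + (1 - 6 * b ^ 2) ^ 2 + 324 * b ^ 4) + 24 * a ^ 4 + 60 * b ^ 4 + 60 * b ^ 6 := by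
      ring
    rw [this]; positivity
  refine (mul_nonneg_iff_of_pos_left hA).mp ?_
  have : (2 + 12 * a ^ 2 + 2 * b ^ 2) * (p ^ 2 * (2 + 12 * a ^ 2 + 2 * b ^ 2) + 8 * (p * q * a * b)
      + q ^ 2 * (2 * a ^ 2 + 30 * b ^ 4 + K))
      = ((2 + 12 * a ^ 2 + 2 * b ^ 2) * p + 4 * a * b * q) ^ 2
        + ((2 + 12 * a ^ 2 + 2 * b ^ 2) * (2 * a ^ 2 + 30 * b ^ 4) - (4 * a * b) ^ 2) * q ^ 2
        + (2 + 12 * a ^ 2 + 2 * b ^ 2) * K * q ^ 2 := by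
    ring
  rw [this]
  positivity

theorem totalDegree_bivariateExample {d : ℕ} (hd : 6 ≤ d) :
    (bivariateExample d).totalDegree = d := by
  refine le_antisymm ?_ ?_
  · have hX : ∀ (i : Fin 2) (k : ℕ),
        (MvPolynomial.X i ^ k : MvPolynomial (Fin 2) ℝ).totalDegree = k := fun i k =>
      MvPolynomial.totalDegree_X_pow i k
    have hXX := MvPolynomial.totalDegree_mul (MvPolynomial.X 0 ^ 2 : MvPolynomial (Fin 2) ℝ)
      (MvPolynomial.X 1 ^ 2)
    simp only [hX] at hXX
    refine (MvPolynomial.totalDegree_add _ _).trans (max_le ?_ (hX _ _).le)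
    refine (MvPolynomial.totalDegree_add _ _).trans (max_le ?_ ((hX _ _).le.trans hd))
    refine (MvPolynomial.totalDegree_add _ _).trans (max_le ?_ (hXX.trans (by omega)))
    refine (MvPolynomial.totalDegree_add _ _).trans (max_le ?_ ((hX _ _).le.trans (by omega)))
    exact (hX _ _).le.trans (by omega)
  -- On the line `x = 0` the polynomial is `y ^ 6 + y ^ d`, whose coefficient at `d` is 1, or 2 if
  -- `d = 6`.
  · have h := MvPolynomial.aeval_natDegree_le (bivariateExample d) le_rfl
      (![0, X] : Fin 2 → ℝ[X]) (n := 1) (by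
        intro i; fin_cases i <;> simp)
    rw [mul_one] at h
    refine le_trans (le_natDegree_of_ne_zero ?_) h
    simp only [bivariateExample, map_add, map_mul, map_pow, MvPolynomial.aeval_X,
      Matrix.cons_val_zero, Matrix.cons_val_one, coeff_add, coeff_X_pow]
    by_cases h6 : d = 6 <;> simp [h6]

end Bivariate

/-! ### A convex, not SOS convex quartic in three variables. -/

section Trivariate

/-- The polynomial
`48 x² + 12 y² + 12 z² + 24 x y z + x⁴ + 12 y⁴ + 12 z⁴ + 12 x² y² + 12 x² z²`. -/
noncomputable def trivariateExample : MvPolynomial (Fin 3) ℝ :=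
  48 * .X 0 ^ 2 + 12 * .X 1 ^ 2 + 12 * .X 2 ^ 2 + 24 * (.X 0 * .X 1 * .X 2) + .X 0 ^ 4
    + 12 * .X 1 ^ 4 + 12 * .X 2 ^ 4 + 12 * (.X 0 ^ 2 * .X 1 ^ 2) + 12 * (.X 0 ^ 2 * .X 2 ^ 2)

theorem hessian_trivariateExample {S : Type*} [CommRing S] [Algebra ℝ S] (x v : Fin 3 → S) :
    ∑ i, ∑ j, v i * MvPolynomial.aeval x
      (MvPolynomial.pderiv i (MvPolynomial.pderiv j trivariateExample)) * v j
    = v 0 ^ 2 * (96 + 12 * x 0 ^ 2 + 24 * x 1 ^ 2 + 24 * x 2 ^ 2)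
      + 24 * v 1 ^ 2 * (1 + 6 * x 1 ^ 2 + x 0 ^ 2) + 24 * v 2 ^ 2 * (1 + 6 * x 2 ^ 2 + x 0 ^ 2)
      + 48 * (v 0 * v 1 * (x 2 + 2 * x 0 * x 1)) + 48 * (v 0 * v 2 * (x 1 + 2 * x 0 * x 2))
      + 48 * (v 1 * v 2 * x 0) := by
  have h01 : (0 : Fin 3) ≠ 1 := by decide
  have h02 : (0 : Fin 3) ≠ 2 := by decide
  have h12 : (1 : Fin 3) ≠ 2 := by decide
  have hofNat : ∀ (i : Fin 3) (n : ℕ) [n.AtLeastTwo],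
    MvPolynomial.pderiv i (OfNat.ofNat n : MvPolynomial (Fin 3) ℝ) = 0 := fun i n _ =>
      Derivation.map_natCast _ n
  simp only [Fin.sum_univ_three, trivariateExample, map_add, Derivation.leibniz,
    Derivation.leibniz_pow, MvPolynomial.pderiv_X_self, MvPolynomial.pderiv_X_of_ne h01,
    MvPolynomial.pderiv_X_of_ne h01.symm, MvPolynomial.pderiv_X_of_ne h02,
    MvPolynomial.pderiv_X_of_ne h02.symm, MvPolynomial.pderiv_X_of_ne h12,
    MvPolynomial.pderiv_X_of_ne h12.symm, smul_eq_mul, map_mul, map_pow, map_ofNat,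
    MvPolynomial.aeval_X, map_one, map_zero, Derivation.map_one_eq_zero, nsmul_eq_mul, map_natCast,
    Derivation.map_natCast, hofNat]
  push_cast
  ring

/-- The left side is the Hessian form in direction `(1, -z, -y)`, which cancels the pure `y ^ 2` and
`z ^ 2` terms and leaves `96 + 288 y² z² - 144 x y z + (12 + 24 y² + 24 z²) x²`, with `x` outermost
and `z` innermost. The term `x y z` arises only from the `y z` parts `c` of `A` and the constant
parts `b` of `B`, where `∑ c² = 288` and `∑ b² = 12`. -/
theorem trivariate_ne_sum_mul_self {n : ℕ} (s : Fin n → ℝ[X][X][X]) :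
    (C (C 96 + C (288 * X ^ 2) * X ^ 2) + C (C (-144 * X) * X) * X
      + C (C (12 + 24 * X ^ 2) + C 24 * X ^ 2) * X ^ 2 : ℝ[X][X][X])
      ≠ ∑ i, s i * s i := by
  intro hs
  obtain ⟨A, B, -, hA, hAB, hB⟩ := exists_affine_of_sum_mul_self_eq hs.symm
  obtain ⟨A0, A1, hA', hA0, -, hA1⟩ := exists_affine_of_sum_mul_self_eq (p := 96)
    (q := 0) (r := 288 * X ^ 2) (by rw [hA]; simp)
  obtain ⟨B0, B1, hB', hB0, -, hB1⟩ := exists_affine_of_sum_mul_self_eq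
    (p := 12 + 24 * X ^ 2) (q := 0) (r := 24) (by rw [hB]; simp)
  obtain ⟨α, α', hA0', -, -, hα'⟩ := exists_affine_of_sum_mul_self_eq (p := 96)
    (q := 0) (r := 0) (hA0.trans (by simp only [map_ofNat, map_zero]; ring))
  obtain ⟨a, c, hA1', ha, -, hc⟩ := exists_affine_of_sum_mul_self_eq (p := 0)
    (q := 0) (r := 288) (hA1.trans (by simp only [map_ofNat, map_zero]; ring))
  obtain ⟨b, b', hB0', hb, -, -⟩ := exists_affine_of_sum_mul_self_eq (p := 12)
    (q := 0) (r := 24) (hB0.trans (by simp only [map_ofNat, map_zero]; ring))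
  obtain ⟨β, β', hB1', -, -, hβ'⟩ := exists_affine_of_sum_mul_self_eq (p := 24)
    (q := 0) (r := 0) (hB1.trans (by simp only [map_ofNat, map_zero]; ring))
  replace hα' := eq_zero_of_sum_mul_self_eq_zero hα'
  replace hβ' := eq_zero_of_sum_mul_self_eq_zero hβ'
  replace ha := eq_zero_of_sum_mul_self_eq_zero ha
  have key : 2 * ∑ i, c i * b i = -144 := by
    have := congrArg (fun p => (p.coeff 1).coeff 1) hAB
    simpa [hA', hB', mul_coeff_one, coeff_C, hA0', hA1', hB0', hB1', hα', hβ', ha] using this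
  -- With `∑ c b = -72`, the sum for a multiplier `μ` is `288 - 144 μ + 12 μ²`, which is smallest at
  -- `μ = 6`, where it is `-144`.
  have h3 : 0 ≤ ∑ i, (c i + 6 * b i) * (c i + 6 * b i) :=
    Finset.sum_nonneg fun i _ => mul_self_nonneg _
  have h4 : ∑ i, (c i + 6 * b i) * (c i + 6 * b i)
      = ∑ i, c i * c i + 12 * ∑ i, c i * b i + 36 * ∑ i, b i * b i := by
    rw [Finset.mul_sum, Finset.mul_sum, ← Finset.sum_add_distrib, ← Finset.sum_add_distrib]
    exact Finset.sum_congr rfl fun i _ => by ring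
  linarith

theorem not_isSOSConvex_trivariateExample : ¬ IsSOSConvex trivariateExample := by
  intro h
  let φ : MvPolynomial (Fin 3 ⊕ Fin 3) ℝ →ₐ[ℝ] ℝ[X][X][X] :=
    MvPolynomial.aeval
    (Sum.elim (![X, C X, C (C X)] : Fin 3 → ℝ[X][X][X])
      (![1, -(C (C X) : ℝ[X][X][X]), -(C X : ℝ[X][X][X])] : Fin 3 → ℝ[X][X][X]))
  have h1 := isSumSq_map φ h
  simp only [map_sum, map_mul, φ, MvPolynomial.aeval_X, MvPolynomial.aeval_rename,
    Sum.elim_comp_inl, Sum.elim_inr] at h1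
  rw [hessian_trivariateExample (S := ℝ[X][X][X])] at h1
  obtain ⟨n, s, hs⟩ := exists_sum_mul_self_of_isSumSq (R := ℝ[X][X][X]) h1
  refine trivariate_ne_sum_mul_self s (Eq.trans ?_ hs)
  simp only [Matrix.cons_val_zero, Matrix.cons_val_one, Matrix.cons_val, map_add, map_mul, map_pow,
    map_ofNat, map_neg]
  ring

/-- Sylvester-type criterion by completing squares; the last hypothesis concerns the full
determinant, which may vanish. -/
theorem ternary_quadratic_nonneg {a b c d e f : ℝ} (hb : 0 < b) (hbc : 0 < b * c - f ^ 2)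
    (hdet : 0 ≤ a * (b * c - f ^ 2) - c * d ^ 2 - b * e ^ 2 + 2 * d * e * f) (p q r : ℝ) :
    0 ≤ a * p ^ 2 + b * q ^ 2 + c * r ^ 2 + 2 * d * p * q + 2 * e * p * r + 2 * f * q * r := by
  have h : b * (b * c - f ^ 2)
      * (a * p ^ 2 + b * q ^ 2 + c * r ^ 2 + 2 * d * p * q + 2 * e * p * r + 2 * f * q * r)
      = (b * c - f ^ 2) * (b * q + d * p + f * r) ^ 2
        + ((b * c - f ^ 2) * r + (b * e - d * f) * p) ^ 2
        + b * (a * (b * c - f ^ 2) - c * d ^ 2 - b * e ^ 2 + 2 * d * e * f) * p ^ 2 := by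
    ring
  refine (mul_nonneg_iff_of_pos_left (mul_pos hb hbc)).mp ?_
  rw [h]
  positivity

/-- This is the determinant of the Hessian divided by 24. It is symmetric in `y` and `z`, and is
rewritten through `S = y² + z²` and `u = y z`, with `4 u² ≤ S²`. -/
theorem trivariate_det_nonneg (x y z : ℝ) :
    0 ≤ (4 + x ^ 2 / 2 + y ^ 2 + z ^ 2)
        * ((1 + 6 * y ^ 2 + x ^ 2) * (1 + 6 * z ^ 2 + x ^ 2) - x ^ 2)
      - (1 + 6 * z ^ 2 + x ^ 2) * (z + 2 * x * y) ^ 2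
      - (1 + 6 * y ^ 2 + x ^ 2) * (y + 2 * x * z) ^ 2
      + 2 * (z + 2 * x * y) * (y + 2 * x * z) * x := by
  have hSu : ∃ S u : ℝ, S = y ^ 2 + z ^ 2 ∧ u = y * z := ⟨_, _, rfl, rfl⟩
  obtain ⟨S, u, hS, hu⟩ := hSu
  have hS0 : 0 ≤ S := by rw [hS]; positivity
  have hSu : 4 * u ^ 2 ≤ S ^ 2 := by
    rw [hS, hu]; nlinarith [sq_nonneg (y ^ 2 - z ^ 2)]
  have hdet : (4 + x ^ 2 / 2 + y ^ 2 + z ^ 2)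
        * ((1 + 6 * y ^ 2 + x ^ 2) * (1 + 6 * z ^ 2 + x ^ 2) - x ^ 2)
      - (1 + 6 * z ^ 2 + x ^ 2) * (z + 2 * x * y) ^ 2
      - (1 + 6 * y ^ 2 + x ^ 2) * (y + 2 * x * z) ^ 2
      + 2 * (z + 2 * x * y) * (y + 2 * x * z) * x
      = 4 + 3 / 2 * x ^ 2 + 3 * (x - u) ^ 2 + 9 / 2 * x ^ 4 + 24 * S + 19 * S * x ^ 2
        + 153 * u ^ 2 + 6 * x ^ 2 * (S ^ 2 - 4 * u ^ 2) + 2 * S * (3 * u - 2 * x) ^ 2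
        + (18 * u ^ 2 * S - 6 * x ^ 2 * u ^ 2 + (x ^ 2) ^ 3 / 2) := by
    rw [hS, hu]; ring
  have hrest : 0 ≤ 18 * u ^ 2 * S - 6 * x ^ 2 * u ^ 2 + (x ^ 2) ^ 3 / 2 := by
    have hX := sq_nonneg x
    generalize x ^ 2 = X at *
    -- If `X ≤ 3 S`, the first term absorbs the negative one. Otherwise `36 u² ≤ 9 S² ≤ X²`, and the
    -- cubic term does.
    rcases le_total X (3 * S) with h | h
    · have := mul_nonneg (sq_nonneg u) (sub_nonneg.mpr h)
      have := pow_nonneg hX 3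
      linarith
    · have h9 : 36 * u ^ 2 ≤ X ^ 2 := by nlinarith
      have := mul_nonneg hX (sub_nonneg.mpr h9)
      have := mul_nonneg (sq_nonneg u) hS0
      have := pow_nonneg hX 3
      nlinarith
  rw [hdet]
  have := sub_nonneg.mpr hSu
  positivity

theorem isConvexPoly_trivariateExample : IsConvexPoly trivariateExample := by
  refine isConvexPoly_of_hessian_nonneg fun x v => ?_
  have h := hessian_trivariateExample x v
  simp only [aeval_eq_eval] at h
  rw [h]
  have h1 := ternary_quadratic_nonneg (b := 1 + 6 * x 1 ^ 2 + x 0 ^ 2) (by positivity)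
    (c := 1 + 6 * x 2 ^ 2 + x 0 ^ 2) (f := x 0)
    (lt_of_lt_of_eq (b := 1 + x 0 ^ 2 + x 0 ^ 4 + 6 * (x 1 ^ 2 + x 2 ^ 2) * (1 + x 0 ^ 2)
      + 36 * x 1 ^ 2 * x 2 ^ 2) (by positivity) (by ring))
    (trivariate_det_nonneg (x 0) (x 1) (x 2)) (v 0) (v 1) (v 2)
  linarith

theorem totalDegree_trivariateExample : trivariateExample.totalDegree = 4 := by
  refine le_antisymm ?_ ?_
  · have hadd : ∀ p q : MvPolynomial (Fin 3) ℝ, p.totalDegree ≤ 4 → q.totalDegree ≤ 4 →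
        (p + q).totalDegree ≤ 4 := fun p q hp hq =>
      (MvPolynomial.totalDegree_add _ _).trans (max_le hp hq)
    have hconst : ∀ (n : ℕ) [n.AtLeastTwo] (p : MvPolynomial (Fin 3) ℝ), p.totalDegree ≤ 4 →
        (OfNat.ofNat n * p).totalDegree ≤ 4 := fun n _ p hp => by
      rw [← map_ofNat MvPolynomial.C n, MvPolynomial.C_mul']
      exact (MvPolynomial.totalDegree_smul_le _ _).trans hp
    have hmul : ∀ {k l : ℕ} {p q : MvPolynomial (Fin 3) ℝ}, p.totalDegree ≤ k →
        q.totalDegree ≤ l → (p * q).totalDegree ≤ k + l := fun hp hq =>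
      (MvPolynomial.totalDegree_mul _ _).trans (add_le_add hp hq)
    have hX1 : ∀ i : Fin 3, (MvPolynomial.X i : MvPolynomial (Fin 3) ℝ).totalDegree ≤ 1 :=
      fun i => (MvPolynomial.totalDegree_X i).le
    have hX2 : ∀ i : Fin 3, (MvPolynomial.X i ^ 2 : MvPolynomial (Fin 3) ℝ).totalDegree ≤ 2 :=
      fun i => (MvPolynomial.totalDegree_X_pow i 2).le
    have hX4 : ∀ i : Fin 3, (MvPolynomial.X i ^ 4 : MvPolynomial (Fin 3) ℝ).totalDegree ≤ 4 :=
      fun i => (MvPolynomial.totalDegree_X_pow i 4).le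
    have h2 : ∀ i : Fin 3, (MvPolynomial.X i ^ 2 : MvPolynomial (Fin 3) ℝ).totalDegree ≤ 4 :=
      fun i => (hX2 i).trans (by omega)
    exact hadd _ _ (hadd _ _ (hadd _ _ (hadd _ _ (hadd _ _ (hadd _ _ (hadd _ _ (hadd _ _
      (hconst _ _ (h2 _)) (hconst _ _ (h2 _))) (hconst _ _ (h2 _)))
      (hconst _ _ ((hmul (hmul (hX1 _) (hX1 _)) (hX1 _)).trans (by omega)))) (hX4 _))
      (hconst _ _ (hX4 _))) (hconst _ _ (hX4 _)))
      (hconst _ _ (hmul (hX2 _) (hX2 _)))) (hconst _ _ (hmul (hX2 _) (hX2 _)))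
  -- On the line `y = z = 0` the term `x ^ 4` survives.
  · have h := MvPolynomial.aeval_natDegree_le trivariateExample le_rfl
      (![X, 0, 0] : Fin 3 → ℝ[X]) (n := 1) (by
        intro i; fin_cases i <;> simp)
    rw [mul_one] at h
    refine le_trans (le_natDegree_of_ne_zero ?_) h
    simp [trivariateExample, coeff_X_pow, coeff_ofNat_mul]

end Trivariate

/-! ### Convex polynomials that are not SOS convex, in every admissible dimension and degree. -/

section Existence

theorem exists_isConvexPoly_not_isSOSConvex {k d : ℕ} (hk : 2 ≤ k) (hd : 2 < d) (hd_even : Even d)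
    (hkd : (k, d) ≠ (2, 4)) :
    ∃ g : MvPolynomial (Fin k) ℝ, g.totalDegree = d ∧ IsConvexPoly g ∧ ¬ IsSOSConvex g := by
  obtain rfl | h6 : d = 4 ∨ 6 ≤ d := by
    obtain ⟨r, rfl⟩ := hd_even
    omega
  · have hk3 : 3 ≤ k := by
      by_contra hlt
      exact hkd (by rw [show k = 2 by omega])
    have he := Fin.castLE_injective hk3
    exact ⟨MvPolynomial.rename (Fin.castLE hk3) trivariateExample,
      (totalDegree_rename_of_injective he _).trans totalDegree_trivariateExample,
      isConvexPoly_trivariateExample.rename _,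
      fun h => not_isSOSConvex_trivariateExample (isSOSConvex_of_rename he h)⟩
  · have he := Fin.castLE_injective hk
    exact ⟨MvPolynomial.rename (Fin.castLE hk) (bivariateExample d),
      (totalDegree_rename_of_injective he _).trans (totalDegree_bivariateExample h6),
      (isConvexPoly_bivariateExample hd_even).rename _,
      fun h => not_isSOSConvex_bivariateExample h6 (isSOSConvex_of_rename he h)⟩

end Existence

end PolyconvexSOS

theorem mainTheorem2 (m n d : ℕ) (hm : 2 ≤ m) (hn : 2 ≤ n) (hd : 2 < d) (hd_even : Even d)
    (hmnd : (m, d) ≠ (2, 4) ∨ (n, d) ≠ (2, 4)) :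
    ∃ f : MvPolynomial (Fin m × Fin n) ℝ,
      f.totalDegree = d ∧
      PolyconvexSOS.IsPolyconvex (fun X => (PolyconvexSOS.evalMatrix f X : EReal)) ∧
      ¬ PolyconvexSOS.IsSOSPolyconvex f ∧
      -- the shape of the example: a polynomial of the first column, or of the first row
      ((m, d) ≠ (2, 4) → ∃ g : MvPolynomial (Fin m) ℝ,
        g.totalDegree = d ∧ PolyconvexSOS.IsConvexPoly g ∧ ¬ PolyconvexSOS.IsSOSConvex g ∧
        f = MvPolynomial.rename (fun i : Fin m => (i, (⟨0, by omega⟩ : Fin n))) g) ∧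
      ((m, d) = (2, 4) → ∃ g : MvPolynomial (Fin n) ℝ,
        g.totalDegree = d ∧ PolyconvexSOS.IsConvexPoly g ∧ ¬ PolyconvexSOS.IsSOSConvex g ∧
        f = MvPolynomial.rename (fun j : Fin n => ((⟨0, by omega⟩ : Fin m), j)) g) := by
  have main : ∀ {k : ℕ} {e : Fin k → Fin m × Fin n} (_ : PolyconvexSOS.IsRankOnePlacement e)
      {g : MvPolynomial (Fin k) ℝ}, g.totalDegree = d → PolyconvexSOS.IsConvexPoly g →
      ¬ PolyconvexSOS.IsSOSConvex g →
      (MvPolynomial.rename e g).totalDegree = d ∧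
      PolyconvexSOS.IsPolyconvex
        (fun X => (PolyconvexSOS.evalMatrix (MvPolynomial.rename e g) X : EReal)) ∧
      ¬ PolyconvexSOS.IsSOSPolyconvex (MvPolynomial.rename e g) := fun he _ hd hc hs =>
    ⟨(PolyconvexSOS.totalDegree_rename_of_injective he.injective _).trans hd,
      PolyconvexSOS.isPolyconvex_rename hc _,
      fun h => hs (PolyconvexSOS.isSOSConvex_of_isSOSPolyconvex_rename he h)⟩
  by_cases hmd : (m, d) = (2, 4)
  · have hnd : (n, d) ≠ (2, 4) := hmnd.resolve_left fun h => h hmd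
    obtain ⟨g, hdeg, hconv, hsos⟩ :=
      PolyconvexSOS.exists_isConvexPoly_not_isSOSConvex hn hd hd_even hnd
    obtain ⟨h1, h2, h3⟩ := main (PolyconvexSOS.isRankOnePlacement_row _) hdeg hconv hsos
    exact ⟨_, h1, h2, h3, fun h => absurd hmd h, fun _ => ⟨g, hdeg, hconv, hsos, rfl⟩⟩
  · obtain ⟨g, hdeg, hconv, hsos⟩ :=
      PolyconvexSOS.exists_isConvexPoly_not_isSOSConvex hm hd hd_even hmd
    obtain ⟨h1, h2, h3⟩ := main (PolyconvexSOS.isRankOnePlacement_col _) hdeg hconv hsos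
    exact ⟨_, h1, h2, h3, fun _ => ⟨g, hdeg, hconv, hsos, rfl⟩, fun h => absurd h hmd⟩
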